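/- Let $[n]=\{1,\dots,n\}$. Say that a matrix $A \in \mathbb{R}^{n\times n}$ has *rows in intersecting cube facets* if for any two distinct rows $a$ and $b$ of $A$ (rows with different row indices) and every $j \in [n]$ such that $|a_j| \ge |a_i|$ and $|b_j| \ge |b_i|$ for all $i \in [n]$, one has $a_j b_j > 0$. **Theorem.** Let $d \ge 0$ be an integer, let $S^d \subset \mathbb{R}^{d+1}$ be the unit sphere, and let $f \colon S^d \to \mathbb{R}^{(d+1)\times(d+1)}$ be continuous and odd, that is, $f(-x) = -f(x)$ for all $x \in S^d$. Then there is an $x \in S^d$ such that either $f(x)$ does not have rows in intersecting cube facets, or there is a permutation $\pi$ of $[d+1]$ such that $f(x)_{\pi(i)i}$ is non-negative and $|f(x)_{\pi(i)i}| \ge |f(x)_{\pi(i)j}|$ for all $i, j \in [d+1]$. -/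

import Mathlib

/-- A square real matrix has rows in intersecting cube facets if for any two distinct rows `a`, `b`
(rows with different row indices), whenever some column `j` carries an entry of maximal absolute
value of both rows, then `a j * b j > 0`. -/
def RowsInIntersectingCubeFacets {n : ℕ} (A : Matrix (Fin n) (Fin n) ℝ) : Prop :=
  ∀ k l : Fin n, k ≠ l → ∀ j : Fin n,
    (∀ i : Fin n, |A k i| ≤ |A k j| ∧ |A l i| ≤ |A l j|) → 0 < A k j * A l j

/-!
The Borsuk–Ulam theorem makes the columns of a suitable matrix-valued odd map equal in sum, and
Birkhoff's theorem then extracts the permutation.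

Suppose that the rows of `f x` always lie in intersecting cube facets. By compactness there is an
`η > 0` such that, for all `x`, entries of different rows in a common column that are within `η` of
the maximal absolute value of their rows have the same sign. Soft thresholding of each row at `η`
below its maximum, followed by division by the `ℓ¹`-norm of the row, gives a continuous odd
matrix-valued map without opposite signs inside a column (`exists_approx_perm`). Its vector of
column sums is an odd map from the `d`-sphere to `ℝᵈ⁺¹`, so by Borsuk–Ulam, applied to the
differences of coordinates, all column sums agree at some point, and up to passing to the antipode
they are non-negative. As nothing cancels, the entries there are non-negative and the matrix is
doubly stochastic; a permutation in its Birkhoff decomposition picks positive entries of `f x`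
within `η` of the maximum (`exists_perm_pos`). Letting `η` tend to `0` finishes the proof, again by
compactness.

The Borsuk–Ulam theorem (`exists_eq_zero_of_odd`) is proved by the counting argument of Tucker and
Fan with chains modulo 2. The hemispheres of the cross-polytope are chains `c₀, c₁, …` with
`∂ cₖ₊₁ = cₖ + ν cₖ`, where `ν` is the antipodal map, and barycentric subdivision keeps this
relation while making the simplices small (`exists_fine_hemispheres`). An odd map to `ℝⁿ` without
zeros labels each point by a coordinate of largest absolute value together with its sign, and close
points never have complementary labels. The number modulo 2 of simplices of `cₖ` with alternating
labels does not depend on `k` (`FinsetChain.altCount_pushChain_eq`). It is `1` for `k = 0`, but `0`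
for `k = n`, since `n + 1` labels without repetition or complementary pair need more than `n`
coordinates.
-/

open Finsupp Filter Topology

/-! ### Ordered chains modulo 2 -/

/-- Ordered simplicial chains with coefficients in `ZMod 2` on the vertex set `X`, in all degrees
at once: a list of `k + 1` vertices is a (possibly degenerate) `k`-simplex. The empty list is the
simplex of degree `-1`, so that the complex is augmented. -/
abbrev ListChain (X : Type*) := List X →₀ ZMod 2

namespace ListChain

variable {X : Type*}

/-- The cone with apex `a`. -/
noncomputable def cone (a : X) : ListChain X →ₗ[ZMod 2] ListChain X :=
  Finsupp.lmapDomain _ _ (List.cons a)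

/-- The boundary of a single ordered simplex: the sum of its facets. -/
noncomputable def simplexBd : List X → ListChain X
  | [] => 0
  | a :: l => single l 1 + cone a (simplexBd l)

/-- The boundary operator. -/
noncomputable def bd : ListChain X →ₗ[ZMod 2] ListChain X :=
  Finsupp.linearCombination (ZMod 2) simplexBd

@[simp] lemma cone_single (a : X) (l : List X) :
    cone a (single l 1) = single (a :: l) 1 := by
  simp [cone]

@[simp] lemma bd_single (l : List X) : bd (single l 1) = simplexBd l := by
  simp [bd]

/-- The cone is a contracting homotopy of the augmented complex. -/
lemma bd_cone (a : X) (c : ListChain X) : bd (cone a c) = c + cone a (bd c) := by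
  have : bd ∘ₗ cone a = LinearMap.id + cone a ∘ₗ bd := by
    ext1 l; ext1
    simp [simplexBd]
  exact LinearMap.congr_fun this c

lemma bd_simplexBd (l : List X) : bd (simplexBd l) = 0 := by
  induction l with
  | nil => simp [simplexBd]
  | cons a l ih => simp [simplexBd, bd_cone, ih, ZModModule.add_self]

/-- The chain map induced by a map of vertices. -/
noncomputable def map {Y : Type*} (φ : X → Y) : ListChain X →ₗ[ZMod 2] ListChain Y :=
  Finsupp.lmapDomain _ _ (List.map φ)

@[simp] lemma map_single {Y : Type*} (φ : X → Y) (l : List X) :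
    map φ (single l 1) = single (l.map φ) 1 := by
  simp [map]

lemma map_cone {Y : Type*} (φ : X → Y) (a : X) (c : ListChain X) :
    map φ (cone a c) = cone (φ a) (map φ c) := by
  have : map φ ∘ₗ cone a = cone (φ a) ∘ₗ map φ := by
    ext1 l; ext1
    simp
  exact LinearMap.congr_fun this c

lemma bd_map {Y : Type*} (φ : X → Y) (c : ListChain X) : bd (map φ c) = map φ (bd c) := by
  have : bd ∘ₗ map φ = map φ ∘ₗ bd := by
    ext1 l; ext1
    simp only [LinearMap.coe_comp, Function.comp_apply, lsingle_apply, map_single, bd_single]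
    induction l with
    | nil => simp [simplexBd]
    | cons a l ih => simp [simplexBd, map_cone, ih]
  exact LinearMap.congr_fun this c

lemma map_map_of_involutive {φ : X → X} (h : Function.Involutive φ) (c : ListChain X) :
    map φ (map φ c) = c := by
  have : map φ ∘ₗ map φ = LinearMap.id := by
    ext1 l; ext1
    simp [h.comp_self]
  exact LinearMap.congr_fun this c

end ListChain

/-- To send chains supported on `P` into a submodule `M` it suffices to do so on the elements
of `P`. -/
lemma map_mem_of_mem_supported {α V : Type*} [AddCommGroup V] [Module (ZMod 2) V]
    (T : (α →₀ ZMod 2) →ₗ[ZMod 2] V) (M : Submodule (ZMod 2) V) {P : Set α}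
    (h : ∀ l ∈ P, T (single l 1) ∈ M) {c : α →₀ ZMod 2}
    (hc : c ∈ supported (ZMod 2) (ZMod 2) P) : T c ∈ M := by
  rw [supported_eq_span_single] at hc
  have : Submodule.span (ZMod 2) ((fun i => single i (1 : ZMod 2)) '' P) ≤ M.comap T := by
    rw [Submodule.span_le]
    rintro _ ⟨l, hl, rfl⟩
    exact h l hl
  exact this hc

/-- Two linear maps that agree on the elements of `P` agree on chains supported on `P`. -/
lemma eq_of_mem_supported {α V : Type*} [AddCommGroup V] [Module (ZMod 2) V]
    (T T' : (α →₀ ZMod 2) →ₗ[ZMod 2] V) {P : Set α}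
    (h : ∀ l ∈ P, T (single l 1) = T' (single l 1)) {c : α →₀ ZMod 2}
    (hc : c ∈ supported (ZMod 2) (ZMod 2) P) : T c = T' c := by
  have := map_mem_of_mem_supported (T - T') ⊥ (P := P)
    (fun l hl => by simp [h l hl]) hc
  simpa [sub_eq_zero] using this

lemma single_one_mem_supported {α : Type*} {P : Set α} {l : α} (h : l ∈ P) :
    single l 1 ∈ supported (ZMod 2) (ZMod 2) P :=
  single_mem_supported _ _ h

namespace ListChain

variable {X : Type*}

lemma cone_mem_supported {a : X} {P Q : Set (List X)} (h : ∀ l ∈ P, a :: l ∈ Q)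
    {c : ListChain X} (hc : c ∈ supported (ZMod 2) (ZMod 2) P) :
    cone a c ∈ supported (ZMod 2) (ZMod 2) Q :=
  map_mem_of_mem_supported _ _
    (fun l hl => by simpa using single_one_mem_supported (h l hl)) hc

lemma map_mem_supported {φ : X → X} {P Q : Set (List X)} (h : ∀ l ∈ P, l.map φ ∈ Q)
    {c : ListChain X} (hc : c ∈ supported (ZMod 2) (ZMod 2) P) :
    map φ c ∈ supported (ZMod 2) (ZMod 2) Q :=
  map_mem_of_mem_supported _ _
    (fun l hl => by simpa using single_one_mem_supported (h l hl)) hc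

lemma simplexBd_mem_supported (l : List X) :
    simplexBd l ∈ supported (ZMod 2) (ZMod 2) {l' | l'.length + 1 = l.length ∧ l' ⊆ l} := by
  induction l with
  | nil => simp [simplexBd]
  | cons a l ih =>
    refine Submodule.add_mem _ (single_one_mem_supported (by simp)) (cone_mem_supported ?_ ih)
    rintro l' ⟨h1, h2⟩
    simp only [Set.mem_ofPred_eq, List.length_cons, h1, true_and]
    exact List.cons_subset_cons a h2

end ListChain

/-! ### Unordered chains on a linearly ordered set of labels -/

/-- Simplicial chains with coefficients in `ZMod 2` on the full simplex with vertex set `L`. -/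
abbrev FinsetChain (L : Type*) := Finset L →₀ ZMod 2

namespace FinsetChain

variable {L : Type*} [LinearOrder L]

/-- The cone with apex `a`; the cone over a simplex that already has `a` as a vertex is
degenerate, hence zero. -/
noncomputable def cone (a : L) : FinsetChain L →ₗ[ZMod 2] FinsetChain L :=
  linearCombination (ZMod 2) fun S => if a ∈ S then 0 else single (insert a S) 1

/-- The boundary operator. -/
noncomputable def bd : FinsetChain L →ₗ[ZMod 2] FinsetChain L :=
  linearCombination (ZMod 2) fun S => ∑ v ∈ S, single (S.erase v) 1

lemma cone_single (a : L) (S : Finset L) :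
    cone a (single S 1) = if a ∈ S then 0 else single (insert a S) 1 := by
  simp [cone]

lemma bd_single (S : Finset L) : bd (single S 1) = ∑ v ∈ S, single (S.erase v) 1 := by
  simp [bd]

lemma bd_cone (a : L) (c : FinsetChain L) : bd (cone a c) = c + cone a (bd c) := by
  have : bd ∘ₗ cone a = LinearMap.id + cone a ∘ₗ bd := by
    ext1 S; ext1
    simp only [LinearMap.coe_comp, Function.comp_apply, lsingle_apply, LinearMap.add_apply,
      LinearMap.id_apply, cone_single, bd_single, map_sum, Finset.mem_erase]
    by_cases ha : a ∈ S
    · -- only the facet opposite to `a` contributes, and it gives back `S`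
      rw [if_pos ha, map_zero, Finset.sum_eq_single_of_mem a ha]
      · simp [Finset.insert_erase ha, ZModModule.add_self]
      · intro b _ hb
        simp [ha, Ne.symm hb]
    · rw [if_neg ha, bd_single, Finset.sum_insert ha, Finset.erase_insert ha]
      congr 1
      refine Finset.sum_congr rfl fun v hv => ?_
      have hva : v ≠ a := fun h => ha (h ▸ hv)
      rw [if_neg (by simp [ha]), Finset.erase_insert_of_ne hva.symm]
  exact LinearMap.congr_fun this c

/-- The chain map that reads off labels: an ordered simplex goes to its set of labels, or to zero
if a label is repeated. -/
noncomputable def push {X : Type*} (lab : X → L) : List X → FinsetChain L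
  | [] => single ∅ 1
  | a :: l => cone (lab a) (push lab l)

/-- The linear extension of `push` to chains. -/
noncomputable def pushChain {X : Type*} (lab : X → L) :
    ListChain X →ₗ[ZMod 2] FinsetChain L :=
  linearCombination (ZMod 2) (push lab)

@[simp] lemma pushChain_single {X : Type*} (lab : X → L) (l : List X) :
    pushChain lab (single l 1) = push lab l := by
  simp [pushChain]

lemma pushChain_cone {X : Type*} (lab : X → L) (a : X) (c : ListChain X) :
    pushChain lab (ListChain.cone a c) = cone (lab a) (pushChain lab c) := by
  have : pushChain lab ∘ₗ ListChain.cone a = cone (lab a) ∘ₗ pushChain lab := by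
    ext1 l; ext1
    simp [push]
  exact LinearMap.congr_fun this c

lemma pushChain_bd {X : Type*} (lab : X → L) (c : ListChain X) :
    pushChain lab (ListChain.bd c) = bd (pushChain lab c) := by
  have : pushChain lab ∘ₗ ListChain.bd = bd ∘ₗ pushChain lab := by
    ext1 l; ext1
    simp only [LinearMap.coe_comp, Function.comp_apply, lsingle_apply, pushChain_single,
      ListChain.bd_single]
    induction l with
    | nil => simp [ListChain.simplexBd, push, bd_single]
    | cons a l ih => simp [ListChain.simplexBd, push, pushChain_cone, ih, bd_cone]
  exact LinearMap.congr_fun this c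

lemma push_mem_supported {X : Type*} (lab : X → L) (l : List X) :
    push lab l ∈ supported (ZMod 2) (ZMod 2)
      {S | S.card = l.length ∧ ∀ x ∈ S, ∃ v ∈ l, lab v = x} := by
  induction l with
  | nil => exact single_one_mem_supported (by simp)
  | cons a l ih =>
    refine map_mem_of_mem_supported _ _ ?_ ih
    rintro S ⟨h1, h2⟩
    rw [cone_single]
    split_ifs with h
    · exact Submodule.zero_mem _
    · refine single_one_mem_supported ⟨by simp [h, h1], ?_⟩
      intro x hx
      rcases Finset.mem_insert.1 hx with rfl | hx
      · exact ⟨a, by simp⟩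
      · obtain ⟨v, hv, rfl⟩ := h2 x hx
        exact ⟨v, by simp [hv]⟩

/-- The chain map induced by a map of labels, to be used for injective maps. -/
noncomputable def map (φ : L → L) : FinsetChain L →ₗ[ZMod 2] FinsetChain L :=
  Finsupp.lmapDomain _ _ (Finset.image φ)

lemma map_single (φ : L → L) (S : Finset L) :
    map φ (single S 1) = single (S.image φ) 1 := by
  simp [map]

lemma map_cone {φ : L → L} (hφ : Function.Injective φ) (a : L) (c : FinsetChain L) :
    map φ (cone a c) = cone (φ a) (map φ c) := by
  have : map φ ∘ₗ cone a = cone (φ a) ∘ₗ map φ := by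
    ext1 S; ext1
    simp only [LinearMap.coe_comp, Function.comp_apply, lsingle_apply, cone_single, map_single,
      Finset.mem_image, hφ.eq_iff, exists_eq_right]
    split_ifs with h
    · simp
    · simp [map_single, Finset.image_insert]
  exact LinearMap.congr_fun this c

lemma push_map {X : Type*} {lab : X → L} {φ : L → L} (hφ : Function.Injective φ) {ν : X → X}
    {l : List X} (h : ∀ v ∈ l, lab (ν v) = φ (lab v)) :
    push lab (l.map ν) = map φ (push lab l) := by
  induction l with
  | nil => simp [push, map_single]
  | cons a l ih =>
    simp only [List.map_cons, push]
    rw [map_cone hφ, h a (by simp), ih fun v hv => h v (by simp [hv])]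

/-! ### Counting alternating simplices -/

/-- For a list of labels with signs `s`, the pair of the indicator that the signs alternate along
the list and the indicator that in addition they start with the sign `1`. The values `(0, 1)` at
the empty list make the recursion uniform. -/
def alternation (s : L → ZMod 2) : List L → ZMod 2 × ZMod 2
  | [] => (0, 1)
  | x :: l => (s x * (alternation s l).1 + (alternation s l).2,
      s x * (s x * (alternation s l).1 + (alternation s l).2))

/-- The number modulo 2 of alternating simplices, their vertices being taken in increasing
order. -/
noncomputable def altCount (s : L → ZMod 2) : FinsetChain L →ₗ[ZMod 2] ZMod 2 :=
  linearCombination (ZMod 2) fun S => (alternation s (S.sort (· ≤ ·))).1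

/-- The number modulo 2 of alternating simplices whose first sign is `1`. -/
noncomputable def posAltCount (s : L → ZMod 2) : FinsetChain L →ₗ[ZMod 2] ZMod 2 :=
  linearCombination (ZMod 2) fun S => (alternation s (S.sort (· ≤ ·))).2

lemma sort_insert_min {a : L} {S : Finset L} (h : ∀ x ∈ S, a < x) :
    (insert a S).sort (· ≤ ·) = a :: S.sort (· ≤ ·) :=
  Finset.sort_insert _ (fun b hb => (h b hb).le) (fun ha => lt_irrefl _ (h a ha))

lemma altCount_insert_min (s : L → ZMod 2) {a : L} {S : Finset L} (h : ∀ x ∈ S, a < x) :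
    altCount s (single (insert a S) 1) =
      s a * altCount s (single S 1) + posAltCount s (single S 1) := by
  simp [altCount, posAltCount, sort_insert_min h, alternation]

lemma posAltCount_insert_min (s : L → ZMod 2) {a : L} {S : Finset L} (h : ∀ x ∈ S, a < x) :
    posAltCount s (single (insert a S) 1) = s a * altCount s (single (insert a S) 1) := by
  simp [altCount, posAltCount, sort_insert_min h, alternation]

lemma bd_single_mem_supported (S : Finset L) :
    bd (single S 1) ∈ supported (ZMod 2) (ZMod 2) {T : Finset L | T ⊆ S} := by
  rw [bd_single]
  exact Submodule.sum_mem _ fun v _ => single_one_mem_supported (Finset.erase_subset _ _)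

/-- Modulo 2, the facets of a simplex that alternate and start with `1` are one in number if the
simplex alternates, and zero otherwise. -/
lemma altCount_bd_and_posAltCount_bd (s : L → ZMod 2) (S : Finset L) :
    altCount s (bd (single S 1)) = 0 ∧
      posAltCount s (bd (single S 1)) = altCount s (single S 1) := by
  induction S using Finset.induction_on_min with
  | empty => simp [bd_single, altCount, alternation]
  | insert a S h ih =>
    have ha : a ∉ S := fun ha => lt_irrefl _ (h a ha)
    have h1 : bd (single (insert a S) 1) = single S 1 + cone a (bd (single S 1)) := by
      rw [← bd_cone, cone_single, if_neg ha]
    have h2 : altCount s (cone a (bd (single S 1))) =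
        s a * altCount s (bd (single S 1)) + posAltCount s (bd (single S 1)) := by
      refine eq_of_mem_supported (altCount s ∘ₗ cone a) (s a • altCount s + posAltCount s) ?_
        (bd_single_mem_supported S)
      intro T hT
      have hT' : ∀ x ∈ T, a < x := fun x hx => h x (hT hx)
      have haT : a ∉ T := fun hx => ha (hT hx)
      simp [cone_single, haT, altCount_insert_min s hT']
    have h3 : posAltCount s (cone a (bd (single S 1))) =
        s a * altCount s (cone a (bd (single S 1))) := by
      refine eq_of_mem_supported (posAltCount s ∘ₗ cone a) (s a • (altCount s ∘ₗ cone a)) ?_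
        (bd_single_mem_supported S)
      intro T hT
      have hT' : ∀ x ∈ T, a < x := fun x hx => h x (hT hx)
      have haT : a ∉ T := fun hx => ha (hT hx)
      simp [cone_single, haT, posAltCount_insert_min s hT']
    rw [h1, map_add, map_add, h3, h2, ih.1, ih.2, altCount_insert_min s h]
    constructor
    · rw [mul_zero, zero_add, ZModModule.add_self]
    · ring

lemma posAltCount_bd (s : L → ZMod 2) (c : FinsetChain L) :
    posAltCount s (bd c) = altCount s c := by
  have : posAltCount s ∘ₗ bd = altCount s := by
    ext1 S; ext1
    exact (altCount_bd_and_posAltCount_bd s S).2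
  exact LinearMap.congr_fun this c

/-- Every alternating simplex starts with the sign `1` either itself or after changing all
signs. -/
lemma altCount_image_and_posAltCount_image {s : L → ZMod 2} {φ : L → L}
    (hs : ∀ x, s (φ x) = s x + 1) {S : Finset L} (hφ : StrictMonoOn φ S) :
    altCount s (single (S.image φ) 1) = altCount s (single S 1) ∧
      posAltCount s (single (S.image φ) 1) =
        posAltCount s (single S 1) + altCount s (single S 1) := by
  induction S using Finset.induction_on_min with
  | empty => simp [altCount, posAltCount, alternation]
  | insert a S h ih =>
    obtain ⟨ih1, ih2⟩ := ih (hφ.mono (by simp))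
    have h' : ∀ x ∈ S.image φ, φ a < x := by
      intro x hx
      obtain ⟨y, hy, rfl⟩ := Finset.mem_image.1 hx
      exact hφ (by simp) (by simp [hy]) (h y hy)
    rw [Finset.image_insert, posAltCount_insert_min s h', posAltCount_insert_min s h,
      altCount_insert_min s h', altCount_insert_min s h, ih1, ih2, hs]
    generalize s a = x
    generalize altCount s (single S 1) = y
    generalize posAltCount s (single S 1) = z
    revert x y z
    decide

/-- If `c'` is a chain whose boundary is `c` plus its antipodal copy, then as many simplices of
`c` as of `c'` carry alternating labels, modulo 2. -/
lemma altCount_pushChain_eq {X : Type*} {ν : X → X} {lab : X → L} {φ : L → L} {s : L → ZMod 2}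
    (hφ : Function.Injective φ) (hs : ∀ x, s (φ x) = s x + 1) {c c' : ListChain X}
    (hbd : ListChain.bd c' = c + ListChain.map ν c)
    (hc : c ∈ supported (ZMod 2) (ZMod 2) {l : List X | (∀ v ∈ l, lab (ν v) = φ (lab v)) ∧
      ∀ u ∈ l, ∀ v ∈ l, lab u < lab v → φ (lab u) < φ (lab v)}) :
    altCount s (pushChain lab c') = altCount s (pushChain lab c) := by
  rw [← posAltCount_bd, ← pushChain_bd, hbd, map_add, map_add]
  have : posAltCount s (pushChain lab (ListChain.map ν c)) =
      posAltCount s (pushChain lab c) + altCount s (pushChain lab c) := by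
    refine eq_of_mem_supported (posAltCount s ∘ₗ pushChain lab ∘ₗ ListChain.map ν)
      (posAltCount s ∘ₗ pushChain lab + altCount s ∘ₗ pushChain lab) ?_ hc
    rintro l ⟨h1, h2⟩
    simp only [LinearMap.coe_comp, Function.comp_apply, ListChain.map_single, pushChain_single,
      LinearMap.add_apply, push_map hφ h1]
    refine eq_of_mem_supported (posAltCount s ∘ₗ map φ) (posAltCount s + altCount s) ?_
      (push_mem_supported lab l)
    rintro S ⟨-, hS⟩
    have hmono : StrictMonoOn φ S := by
      intro x hx y hy hxy
      obtain ⟨u, hu, rfl⟩ := hS x hx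
      obtain ⟨v, hv, rfl⟩ := hS y hy
      exact h2 u hu v hv hxy
    simpa [map_single] using (altCount_image_and_posAltCount_image hs hmono).2
  rw [this, ← add_assoc, ZModModule.add_self, zero_add]

end FinsetChain

/-! ### Barycentric subdivision -/

namespace ListChain

variable {E : Type*} [NormedAddCommGroup E] [NormedSpace ℝ E]

/-- The barycentre of a list of points. -/
noncomputable def barycenter (l : List E) : E := (l.length : ℝ)⁻¹ • l.sum

lemma barycenter_map_neg (l : List E) : barycenter (l.map Neg.neg) = -barycenter l := by
  have : (l.map Neg.neg).sum = -l.sum := by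
    induction l with
    | nil => simp
    | cons a l ih => simp [ih, add_comm]
  simp [barycenter, this]

lemma barycenter_singleton (a : E) : barycenter [a] = a := by simp [barycenter]

lemma barycenter_eq_sum (l : List E) :
    barycenter l = ∑ i : Fin l.length, (l.length : ℝ)⁻¹ • l[i] := by
  rw [← Finset.smul_sum, barycenter, ← Fin.sum_univ_getElem l]
  rfl

lemma barycenter_mem {C : Set E} (hC : Convex ℝ C) {l : List E} (hl : l ≠ [])
    (h : ∀ v ∈ l, v ∈ C) : barycenter l ∈ C := by
  have h0 : (l.length : ℝ) ≠ 0 := by simpa using hl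
  rw [barycenter_eq_sum]
  exact hC.sum_mem (fun _ _ => by positivity) (by simp [h0]) fun i _ => h _ (by simp)

lemma dist_barycenter_le {l : List E} {D : ℝ} (hD : ∀ u ∈ l, ∀ v ∈ l, dist u v ≤ D) {v : E}
    (hv : v ∈ l) : dist v (barycenter l) ≤ (1 - (l.length : ℝ)⁻¹) * D := by
  obtain ⟨i, hi, rfl⟩ := List.getElem_of_mem hv
  have h0 : (0 : ℝ) < l.length := by exact_mod_cast (Nat.zero_le i).trans_lt hi
  have h1 : l[i] - barycenter l = ∑ j : Fin l.length, (l.length : ℝ)⁻¹ • (l[i] - l[j]) := by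
    rw [barycenter_eq_sum, ← Finset.smul_sum, ← Finset.smul_sum, Finset.sum_sub_distrib, smul_sub]
    congr 1
    simp only [Finset.sum_const, Finset.card_univ, Fintype.card_fin]
    rw [← Nat.cast_smul_eq_nsmul ℝ, smul_smul, inv_mul_cancel₀ h0.ne', one_smul]
  rw [dist_eq_norm, h1]
  -- the term with `j = i` vanishes, which is where the factor below `1` comes from
  calc ‖∑ j : Fin l.length, (l.length : ℝ)⁻¹ • (l[i] - l[j])‖
      ≤ ∑ j : Fin l.length, ‖(l.length : ℝ)⁻¹ • (l[i] - l[j])‖ := norm_sum_le _ _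
    _ = ∑ j ∈ Finset.univ.erase (⟨i, hi⟩ : Fin l.length),
          ‖(l.length : ℝ)⁻¹ • (l[i] - l[j])‖ := by
        rw [Finset.sum_erase]
        simp
    _ ≤ ∑ j ∈ Finset.univ.erase (⟨i, hi⟩ : Fin l.length), (l.length : ℝ)⁻¹ * D := by
        refine Finset.sum_le_sum fun j _ => ?_
        rw [norm_smul, Real.norm_of_nonneg (by positivity), ← dist_eq_norm]
        gcongr
        exact hD _ (by simp) _ (by simp)
    _ = (1 - (l.length : ℝ)⁻¹) * D := by
        rw [Finset.sum_const, Finset.card_erase_of_mem (Finset.mem_univ _), Finset.card_univ,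
          Fintype.card_fin, nsmul_eq_mul, Nat.cast_sub (by omega)]
        field_simp
        simp [mul_comm]

/-- The barycentric subdivision of a simplex with `k` vertices, by recursion on `k`: the cone,
from the barycentre, over the subdivided boundary. -/
noncomputable def subdivSimplex : ℕ → List E → ListChain E
  | 0, l => single l 1
  | k + 1, l => cone (barycenter l) (linearCombination (ZMod 2) (subdivSimplex k) (simplexBd l))

/-- The barycentric subdivision of chains. -/
noncomputable def subdiv : ListChain E →ₗ[ZMod 2] ListChain E :=
  linearCombination (ZMod 2) fun l => subdivSimplex l.length l

lemma subdiv_single_nil : subdiv (single ([] : List E) 1) = single [] 1 := by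
  simp [subdiv, subdivSimplex]

lemma subdiv_single_of_ne_nil {l : List E} (hl : l ≠ []) :
    subdiv (single l 1) = cone (barycenter l) (subdiv (simplexBd l)) := by
  obtain ⟨k, hk⟩ : ∃ k, l.length = k + 1 :=
    Nat.exists_eq_succ_of_ne_zero (by simpa using hl)
  have : subdiv (single l 1) = subdivSimplex (k + 1) l := by simp [subdiv, hk]
  rw [this, subdivSimplex]
  congr 1
  refine eq_of_mem_supported _ _ ?_ (simplexBd_mem_supported l)
  rintro l' ⟨h, -⟩
  have : l'.length = k := by omega
  simp [subdiv, this]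

lemma bd_subdiv_single (k : ℕ) (l : List E) (hl : l.length = k) :
    bd (subdiv (single l 1)) = subdiv (simplexBd l) := by
  induction k generalizing l with
  | zero =>
    obtain rfl : l = [] := by simpa using hl
    simp [subdiv_single_nil, simplexBd]
  | succ k ih =>
    have h : bd (subdiv (simplexBd l)) = subdiv (bd (simplexBd l)) := by
      refine eq_of_mem_supported (bd ∘ₗ subdiv (E := E)) (subdiv ∘ₗ bd) ?_
        (simplexBd_mem_supported l)
      rintro l' ⟨h, -⟩
      simp [ih l' (by omega)]
    rw [subdiv_single_of_ne_nil (by rintro rfl; simp at hl), bd_cone, h, bd_simplexBd]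
    simp

lemma bd_subdiv (c : ListChain E) : bd (subdiv c) = subdiv (bd c) := by
  have : bd ∘ₗ subdiv (E := E) = subdiv ∘ₗ bd := by
    ext1 l; ext1
    simp [bd_subdiv_single l.length l rfl]
  exact LinearMap.congr_fun this c

lemma map_neg_subdiv_single (k : ℕ) (l : List E) (hl : l.length = k) :
    map Neg.neg (subdiv (single l 1)) = subdiv (single (l.map Neg.neg) 1) := by
  induction k generalizing l with
  | zero =>
    obtain rfl : l = [] := by simpa using hl
    simp [subdiv_single_nil]
  | succ k ih =>
    have h : map Neg.neg (subdiv (simplexBd l)) = subdiv (map Neg.neg (simplexBd l)) := by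
      refine eq_of_mem_supported (map Neg.neg ∘ₗ subdiv (E := E)) (subdiv ∘ₗ map Neg.neg) ?_
        (simplexBd_mem_supported l)
      rintro l' ⟨h, -⟩
      simp [ih l' (by omega)]
    have hl' : l ≠ [] := by rintro rfl; simp at hl
    rw [subdiv_single_of_ne_nil hl', subdiv_single_of_ne_nil (by simpa using hl'), map_cone, h,
      barycenter_map_neg, ← bd_single, ← bd_map, map_single, bd_single]

lemma map_neg_subdiv (c : ListChain E) : map Neg.neg (subdiv c) = subdiv (map Neg.neg c) := by
  have : map Neg.neg ∘ₗ subdiv (E := E) = subdiv ∘ₗ map Neg.neg := by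
    ext1 l; ext1
    simp [map_neg_subdiv_single l.length l rfl]
  exact LinearMap.congr_fun this c

/-- The simplices with `k` vertices, of diameter at most `D`, that lie in the set `C`. -/
def simplicesIn (C : Set E) (k : ℕ) (D : ℝ) : Set (List E) :=
  {l | l.length = k ∧ (∀ v ∈ l, v ∈ C) ∧ ∀ u ∈ l, ∀ v ∈ l, dist u v ≤ D}

lemma subdiv_single_mem_supported {N : ℕ} {k : ℕ} (hk : k ≤ N) {C : Set E} (hC : Convex ℝ C)
    {D : ℝ} {l : List E} (hl : l ∈ simplicesIn C k D) :
    subdiv (single l 1) ∈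
      supported (ZMod 2) (ZMod 2) (simplicesIn C k ((1 - (N : ℝ)⁻¹) * D)) := by
  induction k generalizing l C with
  | zero =>
    obtain rfl : l = [] := by simpa using hl.1
    rw [subdiv_single_nil]
    exact single_one_mem_supported ⟨rfl, by simp, by simp⟩
  | succ k ih =>
    obtain ⟨h1, h2, h3⟩ := hl
    have hl' : l ≠ [] := by rintro rfl; simp at h1
    have hsub : ∀ v ∈ l, v ∈ convexHull ℝ {v | v ∈ l} := fun v hv => subset_convexHull _ _ hv
    have hD : 0 ≤ D := by
      obtain ⟨v, hv⟩ := List.exists_mem_of_ne_nil l hl'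
      simpa using h3 v hv v hv
    have hN : (1 - (l.length : ℝ)⁻¹) * D ≤ (1 - (N : ℝ)⁻¹) * D := by
      have : (0 : ℝ) < l.length := by rw [h1]; positivity
      have : (l.length : ℝ) ≤ N := by rw [h1]; exact_mod_cast hk
      gcongr
    have hball : convexHull ℝ {v | v ∈ l} ⊆
        Metric.closedBall (barycenter l) ((1 - (N : ℝ)⁻¹) * D) := by
      refine convexHull_min ?_ (convex_closedBall _ _)
      intro v hv
      exact (dist_barycenter_le h3 hv).trans hN
    have hCl : convexHull ℝ {v | v ∈ l} ⊆ C := convexHull_min h2 hC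
    rw [subdiv_single_of_ne_nil hl']
    refine cone_mem_supported (P := simplicesIn (convexHull ℝ {v | v ∈ l}) k
      ((1 - (N : ℝ)⁻¹) * D)) ?_ ?_
    · rintro l' ⟨h1', h2', h3'⟩
      refine ⟨by simp [h1'], ?_, ?_⟩
      · intro v hv
        rcases List.mem_cons.1 hv with rfl | hv
        · exact barycenter_mem hC hl' h2
        · exact hCl (h2' v hv)
      · intro u hu v hv
        rcases List.mem_cons.1 hu with rfl | hu <;> rcases List.mem_cons.1 hv with rfl | hv
        · rw [dist_self]
          obtain ⟨v, hv⟩ := List.exists_mem_of_ne_nil l hl'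
          exact dist_nonneg.trans (hball (hsub v hv))
        · rw [dist_comm]
          exact hball (h2' v hv)
        · exact hball (h2' u hu)
        · exact h3' u hu v hv
    · refine map_mem_of_mem_supported _ _ ?_ (simplexBd_mem_supported l)
      rintro l' ⟨h1', h2'⟩
      exact ih (by omega) (convex_convexHull _ _) ⟨by omega, fun v hv => hsub v (h2' hv),
        fun u hu v hv => h3 u (h2' hu) v (h2' hv)⟩

/-- Iterated subdivision makes the simplices of a chain as small as desired while each of them
stays in one of the given convex sets. -/
lemma subdiv_iterate_mem_supported {N k : ℕ} (hk : k ≤ N) {𝒞 : Set (Set E)}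
    (h𝒞 : ∀ C ∈ 𝒞, Convex ℝ C) {D : ℝ} {c : ListChain E}
    (hc : c ∈ supported (ZMod 2) (ZMod 2) (⋃ C ∈ 𝒞, simplicesIn C k D)) (m : ℕ) :
    subdiv^[m] c ∈ supported (ZMod 2) (ZMod 2)
      (⋃ C ∈ 𝒞, simplicesIn C k ((1 - (N : ℝ)⁻¹) ^ m * D)) := by
  induction m with
  | zero => simpa using hc
  | succ m ih =>
    rw [Function.iterate_succ_apply']
    refine map_mem_of_mem_supported _ _ ?_ ih
    intro l hl
    simp only [Set.mem_iUnion] at hl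
    obtain ⟨C, hC, hl⟩ := hl
    refine supported_mono ?_ (subdiv_single_mem_supported hk (h𝒞 C hC) hl)
    rw [pow_succ', mul_assoc]
    exact Set.subset_biUnion_of_mem (u := fun C => simplicesIn C k _) hC

end ListChain

/-! ### Hemispheres of the cross-polytope -/

section CrossPolytope

variable {n : ℕ}

/-- The facet of the cross-polytope in the orthant with signs `ε`. -/
def crossFacet (ε : Fin (n + 1) → ℝ) : Set (EuclideanSpace ℝ (Fin (n + 1))) :=
  {x | (∀ i, 0 ≤ ε i * x i) ∧ ∑ i, ε i * x i = 1}

/-- The boundary of the cross-polytope, that is, the unit sphere of the `ℓ¹`-norm. -/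
def crossBoundary (n : ℕ) : Set (EuclideanSpace ℝ (Fin (n + 1))) := {x | ∑ i, |x i| = 1}

/-- The facets of the cross-polytope. -/
def crossFacets (n : ℕ) : Set (Set (EuclideanSpace ℝ (Fin (n + 1)))) :=
  {C | ∃ ε : Fin (n + 1) → ℝ, (∀ i, |ε i| = 1) ∧ C = crossFacet ε}

lemma convex_crossFacet (ε : Fin (n + 1) → ℝ) : Convex ℝ (crossFacet ε) := by
  rintro x ⟨hx, hx'⟩ y ⟨hy, hy'⟩ a b ha hb hab
  have key : ∀ i, ε i * (a • x + b • y) i = a * (ε i * x i) + b * (ε i * y i) := by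
    intro i
    simp only [PiLp.add_apply, PiLp.smul_apply, smul_eq_mul]
    ring
  refine ⟨fun i => ?_, ?_⟩
  · rw [key]
    exact add_nonneg (mul_nonneg ha (hx i)) (mul_nonneg hb (hy i))
  · simp only [key]
    rw [Finset.sum_add_distrib, ← Finset.mul_sum, ← Finset.mul_sum, hx', hy', mul_one, mul_one, hab]

lemma crossFacet_subset {C : Set (EuclideanSpace ℝ (Fin (n + 1)))} (hC : C ∈ crossFacets n) :
    C ⊆ crossBoundary n := by
  obtain ⟨ε, hε, rfl⟩ := hC
  rintro x ⟨hx, hx'⟩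
  rw [crossBoundary, Set.mem_ofPred_eq, ← hx']
  refine Finset.sum_congr rfl fun i _ => ?_
  rw [← abs_of_nonneg (hx i), abs_mul, hε, one_mul]

lemma isCompact_crossBoundary (n : ℕ) : IsCompact (crossBoundary n) := by
  refine Metric.isCompact_of_isClosed_isBounded ?_ ?_
  · exact isClosed_eq (by fun_prop) continuous_const
  · refine (Metric.isBounded_iff_subset_closedBall 0).2 ⟨1, fun x hx => ?_⟩
    rw [mem_closedBall_zero_iff, EuclideanSpace.norm_eq, Real.sqrt_le_one]
    calc ∑ i, ‖x i‖ ^ 2 ≤ (∑ i, |x i|) ^ 2 := by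
          simpa using Finset.sum_sq_le_sq_sum_of_nonneg (s := Finset.univ)
            (f := fun i => |x i|) (fun i _ => abs_nonneg _)
      _ = 1 := by rw [show ∑ i, |x i| = 1 from hx, one_pow]

/-- The vertices of the cross-polytope with positive sign, with the junk value `0` beyond the
dimension. -/
noncomputable def crossVertex (n k : ℕ) : EuclideanSpace ℝ (Fin (n + 1)) :=
  if h : k < n + 1 then EuclideanSpace.single ⟨k, h⟩ 1 else 0

/-- The `k`-dimensional upper hemisphere of the boundary of the cross-polytope, as a chain: the
cone over the `(k - 1)`-dimensional equator, which is the sum of two antipodal hemispheres. -/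
noncomputable def hemisphere (n : ℕ) : ℕ → ListChain (EuclideanSpace ℝ (Fin (n + 1)))
  | 0 => single [crossVertex n 0] 1
  | k + 1 => ListChain.cone (crossVertex n (k + 1))
      (hemisphere n k + ListChain.map Neg.neg (hemisphere n k))

lemma bd_hemisphere_succ (k : ℕ) : ListChain.bd (hemisphere n (k + 1)) =
    hemisphere n k + ListChain.map Neg.neg (hemisphere n k) := by
  rw [hemisphere, ListChain.bd_cone]
  have : ListChain.bd (hemisphere n k + ListChain.map Neg.neg (hemisphere n k)) = 0 := by
    induction k with
    | zero =>
      simp [hemisphere, ListChain.simplexBd, ZModModule.add_self]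
    | succ k ih =>
      have h1 : ListChain.bd (hemisphere n (k + 1)) =
          hemisphere n k + ListChain.map Neg.neg (hemisphere n k) := by
        rw [hemisphere, ListChain.bd_cone, ih, map_zero, add_zero]
      rw [map_add, ListChain.bd_map, h1, map_add,
        ListChain.map_map_of_involutive neg_involutive,
        add_comm (ListChain.map _ _), ZModModule.add_self]
  rw [this, map_zero, add_zero]

lemma hemisphere_mem_supported_aux {k : ℕ} (hk : k ≤ n) :
    hemisphere n k ∈ supported (ZMod 2) (ZMod 2) {l | l.length = k + 1 ∧
      (∃ ε : Fin (n + 1) → ℝ, (∀ i, |ε i| = 1) ∧ ∀ v ∈ l, v ∈ crossFacet ε) ∧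
      ∀ v ∈ l, ∀ i : Fin (n + 1), k < i → v i = 0} := by
  have hsum : ∀ (j : Fin (n + 1)) (ε : Fin (n + 1) → ℝ), ε j = 1 →
      EuclideanSpace.single j 1 ∈ crossFacet ε := by
    intro j ε hj
    refine ⟨fun i => ?_, ?_⟩
    · by_cases h : i = j
      · subst h
        simp [hj]
      · simp [h]
    · simp [hj]
  induction k with
  | zero =>
    refine single_one_mem_supported ⟨rfl, ⟨fun _ => 1, by simp, ?_⟩, ?_⟩
    · simp only [List.mem_singleton, forall_eq]
      rw [crossVertex, dif_pos (by omega)]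
      exact hsum _ _ rfl
    · simp only [List.mem_singleton, forall_eq]
      intro i hi
      rw [crossVertex, dif_pos (by omega)]
      have : i ≠ 0 := by rintro rfl; simp at hi
      simp [this]
  | succ k ih =>
    have ih := ih (by omega)
    refine ListChain.cone_mem_supported ?_ (Submodule.add_mem _ ih
      (ListChain.map_mem_supported ?_ ih))
    · rintro l ⟨h1, ⟨ε, hε, h2⟩, h3⟩
      have hv : crossVertex n (k + 1) = EuclideanSpace.single ⟨k + 1, by omega⟩ 1 := by
        rw [crossVertex, dif_pos (by omega)]
      refine ⟨by simp [h1], ⟨Function.update ε ⟨k + 1, by omega⟩ 1, fun i => ?_, ?_⟩, ?_⟩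
      · by_cases h : i = ⟨k + 1, by omega⟩
        · subst h
          simp
        · simp [h, hε]
      · intro v hv'
        rcases List.mem_cons.1 hv' with rfl | hv'
        · rw [hv]
          exact hsum _ _ (by simp)
        · have key : ∀ i, Function.update ε ⟨k + 1, by omega⟩ 1 i * v i = ε i * v i := by
            intro i
            by_cases h : i = ⟨k + 1, by omega⟩
            · rw [h3 v hv' i (by rw [h]; simp), mul_zero, mul_zero]
            · rw [Function.update_of_ne h]
          refine ⟨fun i => ?_, ?_⟩
          · rw [key]
            exact (h2 v hv').1 i
          · simp only [key]
            exact (h2 v hv').2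
      · intro v hv' i hi
        rcases List.mem_cons.1 hv' with rfl | hv'
        · rw [hv]
          have : i ≠ ⟨k + 1, by omega⟩ := fun h => by simp [h] at hi
          simp [this]
        · exact h3 v hv' i (by omega)
    · rintro l ⟨h1, ⟨ε, hε, h2⟩, h3⟩
      refine ⟨by simp [h1], ⟨fun i => -ε i, by simpa using hε, ?_⟩, ?_⟩
      · intro v hv
        obtain ⟨u, hu, rfl⟩ := List.mem_map.1 hv
        simpa [crossFacet] using h2 u hu
      · intro v hv i hi
        obtain ⟨u, hu, rfl⟩ := List.mem_map.1 hv
        simpa using h3 u hu i hi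

lemma hemisphere_mem_supported {k : ℕ} (hk : k ≤ n) :
    hemisphere n k ∈ supported (ZMod 2) (ZMod 2)
      (⋃ C ∈ crossFacets n, ListChain.simplicesIn C (k + 1) (Metric.diam (crossBoundary n))) := by
  refine supported_mono ?_ (hemisphere_mem_supported_aux hk)
  rintro l ⟨h1, ⟨ε, hε, h2⟩, -⟩
  have hC : crossFacet ε ∈ crossFacets n := ⟨ε, hε, rfl⟩
  simp only [Set.mem_iUnion]
  exact ⟨_, hC, h1, h2, fun u hu v hv => Metric.dist_le_diam_of_mem
    (isCompact_crossBoundary n).isBounded (crossFacet_subset hC (h2 u hu))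
    (crossFacet_subset hC (h2 v hv))⟩

/-- Arbitrarily fine subdivisions of the hemispheres of the cross-polytope. -/
lemma exists_fine_hemispheres (n : ℕ) {η : ℝ} (hη : 0 < η) :
    ∃ c : ℕ → ListChain (EuclideanSpace ℝ (Fin (n + 1))),
      c 0 = single [crossVertex n 0] 1 ∧
      (∀ k, ListChain.bd (c (k + 1)) = c k + ListChain.map Neg.neg (c k)) ∧
      ∀ k ≤ n, c k ∈ supported (ZMod 2) (ZMod 2) {l | l.length = k + 1 ∧
        (∀ v ∈ l, v ∈ crossBoundary n) ∧ ∀ u ∈ l, ∀ v ∈ l, dist u v < η} := by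
  obtain ⟨m, hm⟩ : ∃ m : ℕ,
      (1 - ((n + 1 : ℕ) : ℝ)⁻¹) ^ m * Metric.diam (crossBoundary n) < η := by
    have h0 : 0 ≤ 1 - ((n + 1 : ℕ) : ℝ)⁻¹ := sub_nonneg.2 (Nat.cast_inv_le_one _)
    have h1 : 1 - ((n + 1 : ℕ) : ℝ)⁻¹ < 1 := sub_lt_self _ (by positivity)
    have := (tendsto_pow_atTop_nhds_zero_of_lt_one h0 h1).mul_const
      (Metric.diam (crossBoundary n))
    rw [zero_mul] at this
    exact (this.eventually_lt_const hη).exists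
  refine ⟨fun k => ListChain.subdiv^[m] (hemisphere n k), ?_, fun k => ?_, fun k hk => ?_⟩
  · have : ListChain.subdiv (single [crossVertex n 0] 1) = single [crossVertex n 0] 1 := by
      rw [ListChain.subdiv_single_of_ne_nil (by simp)]
      simp [ListChain.simplexBd, ListChain.subdiv_single_nil, ListChain.barycenter_singleton]
    exact Function.iterate_fixed this m
  · have h1 : ∀ c : ListChain (EuclideanSpace ℝ (Fin (n + 1))),
        ListChain.bd (ListChain.subdiv^[m] c) = ListChain.subdiv^[m] (ListChain.bd c) :=
      Function.Semiconj.iterate_right (f := ListChain.bd) ListChain.bd_subdiv m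
    have h2 : ∀ c : ListChain (EuclideanSpace ℝ (Fin (n + 1))),
        ListChain.map Neg.neg (ListChain.subdiv^[m] c) =
          ListChain.subdiv^[m] (ListChain.map Neg.neg c) :=
      Function.Semiconj.iterate_right (f := ListChain.map Neg.neg) ListChain.map_neg_subdiv m
    rw [h1, bd_hemisphere_succ, h2, iterate_map_add]
  · have hconv : ∀ C ∈ crossFacets n, Convex ℝ C := by
      rintro C ⟨ε, -, rfl⟩
      exact convex_crossFacet ε
    refine supported_mono ?_ (ListChain.subdiv_iterate_mem_supported (N := n + 1) (by omega) hconv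
      (hemisphere_mem_supported hk) m)
    intro l hl
    simp only [Set.mem_iUnion] at hl
    obtain ⟨C, hC, h1, h2, h3⟩ := hl
    exact ⟨h1, fun v hv => crossFacet_subset hC (h2 v hv),
      fun u hu v hv => (h3 u hu v hv).trans_lt hm⟩

end CrossPolytope

/-! ### The Borsuk–Ulam theorem -/

/-- **Tucker's lemma** on the fine hemispheres: an antipodal labelling of the boundary of the
`(n + 1)`-dimensional cross-polytope by `n` labels with signs has complementary labels at some pair
of close points. -/
lemma exists_complementary_labels {n : ℕ}
    (lab : EuclideanSpace ℝ (Fin (n + 1)) → Fin n ×ₗ Bool)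
    (hlab : ∀ x ∈ crossBoundary n,
      (ofLex (lab (-x))).1 = (ofLex (lab x)).1 ∧ (ofLex (lab (-x))).2 = !(ofLex (lab x)).2)
    {η : ℝ} (hη : 0 < η) :
    ∃ u ∈ crossBoundary n, ∃ v ∈ crossBoundary n, dist u v < η ∧
      (ofLex (lab u)).1 = (ofLex (lab v)).1 ∧
      (ofLex (lab u)).2 = true ∧ (ofLex (lab v)).2 = false := by
  by_contra! H
  obtain ⟨c, hc0, hbd, hc⟩ := exists_fine_hemispheres n hη
  -- simplices without complementary labels have no two different labels in the same column
  have hadm : ∀ u ∈ crossBoundary n, ∀ v ∈ crossBoundary n, dist u v < η →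
      (ofLex (lab u)).1 = (ofLex (lab v)).1 → lab u = lab v := by
    intro u hu v hv huv h
    have h1 := H u hu v hv huv h
    have h2 := H v hv u hu (by rwa [dist_comm]) h.symm
    have h3 : (ofLex (lab u)).2 = (ofLex (lab v)).2 := by
      cases hu' : (ofLex (lab u)).2 <;> cases hv' : (ofLex (lab v)).2 <;> simp_all
    exact ofLex.injective (Prod.ext h h3)
  let φ : Fin n ×ₗ Bool → Fin n ×ₗ Bool := fun x => toLex ((ofLex x).1, !(ofLex x).2)
  let s : Fin n ×ₗ Bool → ZMod 2 := fun x => if (ofLex x).2 then 1 else 0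
  have hφ : Function.Injective φ := by
    intro x y hxy
    have h := congrArg ofLex hxy
    simp only [φ, ofLex_toLex, Prod.mk.injEq, Bool.not_inj_iff] at h
    exact ofLex.injective (Prod.ext h.1 h.2)
  have hs : ∀ x, s (φ x) = s x + 1 := by
    intro x
    simp only [s, φ, ofLex_toLex]
    cases (ofLex x).2 <;> rfl
  have hcount : ∀ k ≤ n,
      FinsetChain.altCount s (FinsetChain.pushChain lab (c k)) = 1 := by
    intro k hk
    induction k with
    | zero =>
      rw [hc0, FinsetChain.pushChain_single, FinsetChain.push, FinsetChain.push,
        FinsetChain.cone_single, if_neg (by simp)]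
      simp [FinsetChain.altCount, FinsetChain.alternation]
    | succ k ih =>
      rw [← ih (by omega)]
      refine FinsetChain.altCount_pushChain_eq hφ hs (hbd k) (supported_mono ?_ (hc k (by omega)))
      rintro l ⟨-, h2, h3⟩
      refine ⟨fun v hv => ?_, fun u hu v hv huv => ?_⟩
      · obtain ⟨h4, h5⟩ := hlab v (h2 v hv)
        exact ofLex.injective (Prod.ext h4 h5)
      · rcases Prod.Lex.lt_iff.1 huv with h | ⟨h, -⟩
        · exact Prod.Lex.lt_iff.2 (Or.inl h)
        · rw [hadm u (h2 u hu) v (h2 v hv) (h3 u hu v hv) h] at huv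
          exact absurd huv (lt_irrefl _)
  have hzero : FinsetChain.pushChain lab (c n) = 0 := by
    refine eq_of_mem_supported _ 0 ?_ (hc n le_rfl)
    rintro l ⟨h1, h2, h3⟩
    rw [FinsetChain.pushChain_single, LinearMap.zero_apply]
    have hmem := FinsetChain.push_mem_supported lab l
    -- the `n + 1` labels of a nondegenerate simplex do not fit into `n` columns
    have hempty : {S : Finset (Fin n ×ₗ Bool) |
        S.card = l.length ∧ ∀ x ∈ S, ∃ v ∈ l, lab v = x} = ∅ := by
      refine Set.eq_empty_of_forall_notMem ?_
      rintro S ⟨hcard, hS⟩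
      have : S.card ≤ (Finset.univ : Finset (Fin n)).card := by
        refine Finset.card_le_card_of_injOn (fun x => (ofLex x).1) (fun _ _ => by simp) ?_
        intro x hx y hy hxy
        obtain ⟨u, hu, rfl⟩ := hS x hx
        obtain ⟨v, hv, rfl⟩ := hS y hy
        exact hadm u (h2 u hu) v (h2 v hv) (h3 u hu v hv) hxy
      rw [hcard, h1, Finset.card_univ, Fintype.card_fin] at this
      omega
    rw [hempty, supported_empty] at hmem
    exact (Submodule.mem_bot _).1 hmem
  have := hcount n le_rfl
  rw [hzero, map_zero] at this
  exact zero_ne_one this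

/-- The **Borsuk–Ulam theorem** on the boundary of the cross-polytope. -/
lemma exists_eq_zero_of_odd_on_crossBoundary {n : ℕ}
    {g : EuclideanSpace ℝ (Fin (n + 1)) → Fin n → ℝ}
    (hg : ContinuousOn g (crossBoundary n)) (hodd : ∀ x, g (-x) = -g x) :
    ∃ x ∈ crossBoundary n, g x = 0 := by
  by_contra! H
  have hcomp := isCompact_crossBoundary n
  have hne : (crossBoundary n).Nonempty :=
    ⟨EuclideanSpace.single 0 1, by
      simp only [crossBoundary, Set.mem_ofPred_eq]
      rw [Finset.sum_eq_single 0] <;> simp +contextual⟩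
  obtain ⟨x₀, hx₀, hmin⟩ := hcomp.exists_isMinOn hne hg.norm
  set δ := ‖g x₀‖ with hδ
  have hδ0 : 0 < δ := norm_pos_iff.2 (H x₀ hx₀)
  have : Nonempty (Fin n) := by
    by_contra hn
    rw [not_nonempty_iff] at hn
    exact H x₀ hx₀ (Subsingleton.elim _ _)
  -- the column of a label is a coordinate of largest absolute value, the sign is its sign
  have hmax : ∀ w : Fin n → ℝ, ∃ j, ∀ i, w i ≤ w j := fun w => Finite.exists_max w
  choose J hJ using hmax
  let col : EuclideanSpace ℝ (Fin (n + 1)) → Fin n := fun x => J fun i => |g x i|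
  have hcol : ∀ x ∈ crossBoundary n, δ ≤ |g x (col x)| := fun x hx =>
    (hmin hx).trans ((pi_norm_le_iff_of_nonneg (abs_nonneg _)).2 fun i =>
      hJ (fun i => |g x i|) i)
  have hcolneg : ∀ x, col (-x) = col x := fun x => by simp [col, hodd]
  obtain ⟨η, hη, hunif⟩ := Metric.uniformContinuousOn_iff.1
    (hcomp.uniformContinuousOn_of_continuous hg) δ hδ0
  let lab : EuclideanSpace ℝ (Fin (n + 1)) → Fin n ×ₗ Bool :=
    fun x => toLex (col x, decide (0 < g x (col x)))
  have hlab : ∀ x ∈ crossBoundary n,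
      (ofLex (lab (-x))).1 = (ofLex (lab x)).1 ∧ (ofLex (lab (-x))).2 = !(ofLex (lab x)).2 := by
    intro x hx
    have h0 : g x (col x) ≠ 0 := fun h => by
      have := hcol x hx
      rw [h, abs_zero] at this
      linarith
    simp only [lab, ofLex_toLex, hcolneg, true_and, hodd, Pi.neg_apply]
    rcases lt_or_gt_of_ne h0 with h | h
    · simp [h, h.le]
    · simp [h, h.le]
  obtain ⟨u, hu, v, hv, huv, h1, h2, h3⟩ := exists_complementary_labels lab hlab hη
  simp only [lab, ofLex_toLex, decide_eq_true_eq, decide_eq_false_iff_not, not_lt] at h1 h2 h3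
  have hu' := hcol u hu
  have hv' := hcol v hv
  rw [abs_of_pos h2] at hu'
  rw [abs_of_nonpos h3, ← h1] at hv'
  have := (dist_le_pi_dist (g u) (g v) (col u)).trans_lt (hunif u hu v hv huv)
  rw [Real.dist_eq] at this
  have := le_abs_self (g u (col u) - g v (col u))
  linarith

/-- The **Borsuk–Ulam theorem**: a continuous odd map from the `d`-sphere to `ℝᵈ` has a zero. -/
theorem exists_eq_zero_of_odd {d : ℕ}
    {f : Metric.sphere (0 : EuclideanSpace ℝ (Fin (d + 1))) 1 → Fin d → ℝ}
    (hf : Continuous f) (hodd : ∀ x, f (-x) = -f x) : ∃ x, f x = 0 := by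
  have hmem : ∀ x : EuclideanSpace ℝ (Fin (d + 1)), x ≠ 0 →
      ‖x‖⁻¹ • x ∈ Metric.sphere (0 : EuclideanSpace ℝ (Fin (d + 1))) 1 := by
    intro x hx
    simp [norm_smul, hx]
  have hne : ∀ x ∈ crossBoundary d, x ≠ 0 := by
    rintro x hx rfl
    simp [crossBoundary] at hx
  let g : EuclideanSpace ℝ (Fin (d + 1)) → Fin d → ℝ :=
    fun x => if hx : x = 0 then 0 else f ⟨‖x‖⁻¹ • x, hmem x hx⟩
  have hg : ContinuousOn g (crossBoundary d) := by
    rw [continuousOn_iff_continuous_domRestrict]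
    have hcont : Continuous fun x : crossBoundary d => ‖x.1‖⁻¹ • x.1 :=
      (continuous_subtype_val.norm.inv₀ fun x => norm_ne_zero_iff.2 (hne x.1 x.2)).smul
        continuous_subtype_val
    refine (hf.comp (hcont.subtype_mk fun x => hmem x.1 (hne x.1 x.2))).congr fun x => ?_
    simp [g, hne x.1 x.2]
  have hgodd : ∀ x, g (-x) = -g x := by
    intro x
    by_cases hx : x = 0
    · simp [g, hx]
    · simp only [g, neg_eq_zero, hx, dif_neg, not_false_eq_true]
      rw [← hodd]
      congr 1
      ext1
      simp
  obtain ⟨x, hx, hgx⟩ := exists_eq_zero_of_odd_on_crossBoundary hg hgodd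
  exact ⟨⟨‖x‖⁻¹ • x, hmem x (hne x hx)⟩, by simpa [g, hne x hx] using hgx⟩

/-! ### Matchings in matrices without cancellation in columns -/

/-- If rows have `ℓ¹`-norm `1`, no column has entries of opposite signs, and all column sums agree
with some `c ≥ 0`, then the matrix is doubly stochastic, so that Birkhoff's theorem gives a
permutation with positive entries. -/
lemma exists_perm_pos {n : ℕ} {B : Matrix (Fin n) (Fin n) ℝ}
    (hcol : ∀ k l j, 0 ≤ B k j * B l j) (hrow : ∀ k, ∑ j, |B k j| = 1) {c : ℝ} (hc : 0 ≤ c)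
    (hsum : ∀ j, ∑ k, B k j = c) : ∃ π : Equiv.Perm (Fin n), ∀ i, 0 < B (π i) i := by
  rcases Nat.eq_zero_or_pos n with rfl | hn
  · exact ⟨1, fun i => i.elim0⟩
  have hnonneg : ∀ k j, 0 ≤ B k j := by
    intro k j
    by_contra! h
    have h1 : ∀ l, B l j ≤ 0 := fun l => by
      by_contra! h'
      exact absurd (hcol k l j) (mul_neg_of_neg_of_pos h h').not_ge
    have h2 : ∑ l, B l j < 0 :=
      Finset.sum_neg_iff_of_nonpos (fun l _ => h1 l) |>.2 ⟨k, Finset.mem_univ _, h⟩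
    rw [hsum] at h2
    exact h2.not_ge hc
  have hrow' : ∀ k, ∑ j, B k j = 1 := fun k => by
    rw [← hrow k]
    exact Finset.sum_congr rfl fun j _ => (abs_of_nonneg (hnonneg k j)).symm
  have hc1 : c = 1 := by
    have h : ∑ j, ∑ k, B k j = ∑ k, ∑ j, B k j := Finset.sum_comm
    simp only [hsum, hrow', Finset.sum_const, Finset.card_univ, Fintype.card_fin,
      nsmul_eq_mul] at h
    have hn' : (n : ℝ) ≠ 0 := by positivity
    exact mul_left_cancel₀ hn' h
  obtain ⟨w, hw, hw1, hwB⟩ := exists_eq_sum_perm_of_mem_doublyStochastic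
    (mem_doublyStochastic_iff_sum.2 ⟨hnonneg, hrow', fun j => (hsum j).trans hc1⟩)
  obtain ⟨σ, hσ⟩ : ∃ σ, 0 < w σ := by
    by_contra! h
    have := Finset.sum_nonpos fun σ (_ : σ ∈ Finset.univ) => h σ
    linarith
  refine ⟨σ⁻¹, fun i => ?_⟩
  rw [← hwB, Matrix.sum_apply]
  refine Finset.sum_pos' (fun τ _ => ?_) ⟨σ, Finset.mem_univ _, ?_⟩
  · rw [Matrix.smul_apply, smul_eq_mul]
    refine mul_nonneg (hw τ) ?_
    simp only [Equiv.Perm.permMatrix, PEquiv.toMatrix_apply]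
    split_ifs <;> norm_num
  · simp [Matrix.smul_apply, Equiv.Perm.permMatrix, PEquiv.toMatrix_apply, hσ]

/-! ### Soft thresholding -/

/-- Soft thresholding at level `τ`: for `τ ≥ 0` it moves `t` towards `0` by `τ`, and vanishes where
`|t| ≤ τ`. -/
noncomputable def softThreshold (t τ : ℝ) : ℝ := max (t - τ) 0 - max (-t - τ) 0

lemma softThreshold_neg (t τ : ℝ) : softThreshold (-t) τ = -softThreshold t τ := by
  simp [softThreshold]

lemma softThreshold_of_abs_le {t τ : ℝ} (h : |t| ≤ τ) : softThreshold t τ = 0 := by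
  have := abs_le.1 h
  rw [softThreshold, max_eq_right (by linarith), max_eq_right (by linarith), sub_zero]

lemma softThreshold_of_lt {t τ : ℝ} (hτ : 0 ≤ τ) (h : τ < t) : softThreshold t τ = t - τ := by
  rw [softThreshold, max_eq_left (by linarith), max_eq_right (by linarith), sub_zero]

lemma softThreshold_of_lt_neg {t τ : ℝ} (hτ : 0 ≤ τ) (h : t < -τ) :
    softThreshold t τ = t + τ := by
  rw [softThreshold, max_eq_right (by linarith), max_eq_left (by linarith)]
  ring

lemma softThreshold_pos_iff {t τ : ℝ} (hτ : 0 ≤ τ) : 0 < softThreshold t τ ↔ τ < t := by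
  refine ⟨fun h => ?_, fun h => by rw [softThreshold_of_lt hτ h]; linarith⟩
  by_contra! h'
  rcases lt_or_ge t (-τ) with h1 | h1
  · rw [softThreshold_of_lt_neg hτ h1] at h
    linarith
  · rw [softThreshold_of_abs_le (abs_le.2 ⟨h1, h'⟩)] at h
    exact lt_irrefl _ h

lemma softThreshold_neg_iff {t τ : ℝ} (hτ : 0 ≤ τ) : softThreshold t τ < 0 ↔ τ < -t := by
  rw [← softThreshold_pos_iff hτ, softThreshold_neg, neg_pos]

lemma softThreshold_mul_nonneg {t u τ υ : ℝ} (hτ : 0 ≤ τ) (hυ : 0 ≤ υ)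
    (h : τ < |t| → υ < |u| → 0 < t * u) : 0 ≤ softThreshold t τ * softThreshold u υ := by
  rcases le_or_gt |t| τ with h1 | h1
  · simp [softThreshold_of_abs_le h1]
  rcases le_or_gt |u| υ with h2 | h2
  · simp [softThreshold_of_abs_le h2]
  rcases mul_pos_iff.1 (h h1 h2) with ⟨ht, hu⟩ | ⟨ht, hu⟩
  · rw [abs_of_pos ht] at h1
    rw [abs_of_pos hu] at h2
    exact mul_nonneg ((softThreshold_pos_iff hτ).2 h1).le ((softThreshold_pos_iff hυ).2 h2).le
  · rw [abs_of_neg ht] at h1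
    rw [abs_of_neg hu] at h2
    exact mul_nonneg_of_nonpos_of_nonpos ((softThreshold_neg_iff hτ).2 h1).le
      ((softThreshold_neg_iff hυ).2 h2).le

lemma softThreshold_ne_zero {t τ : ℝ} (hτ : 0 ≤ τ) (h : τ < |t|) : softThreshold t τ ≠ 0 := by
  rcases lt_abs.1 h with h | h
  · exact ((softThreshold_pos_iff hτ).2 h).ne'
  · exact ((softThreshold_neg_iff hτ).2 h).ne

/-! ### Approximate solutions -/

/-- A continuous odd map into `ℝᵈ⁺¹` meets the ray in the direction `(1, …, 1)`. -/
lemma exists_forall_eq_of_odd {d : ℕ}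
    {F : Metric.sphere (0 : EuclideanSpace ℝ (Fin (d + 1))) 1 → Fin (d + 1) → ℝ}
    (hF : Continuous F) (hodd : ∀ x, F (-x) = -F x) : ∃ x, ∃ c ≥ 0, ∀ j, F x j = c := by
  obtain ⟨x, hx⟩ := exists_eq_zero_of_odd (f := fun x i => F x (Fin.succ i) - F x 0)
    (by fun_prop) (fun x => by funext i; simp [hodd]; ring)
  have h : ∀ j, F x j = F x 0 := by
    intro j
    refine Fin.cases rfl (fun i => ?_) j
    exact sub_eq_zero.1 (congrFun hx i)
  rcases le_total 0 (F x 0) with h0 | h0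
  · exact ⟨x, F x 0, h0, h⟩
  · exact ⟨-x, -F x 0, by simpa using h0, fun j => by rw [hodd, Pi.neg_apply, h]⟩

/-- If entries within `η` of the maximal absolute value of their rows have equal signs in each
column, then at some point there is a matching of rows and columns by positive entries within `η`
of the maximum. -/
lemma exists_approx_perm {d : ℕ}
    {f : Metric.sphere (0 : EuclideanSpace ℝ (Fin (d + 1))) 1 →
      Matrix (Fin (d + 1)) (Fin (d + 1)) ℝ}
    (hcont : Continuous f) (hodd : ∀ x, f (-x) = -f x) {η : ℝ} (hη : 0 < η)
    (hη' : ∀ x k, η ≤ ‖f x k‖)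
    (hsign : ∀ x k l j, k ≠ l → ‖f x k‖ - η < |f x k j| → ‖f x l‖ - η < |f x l j| →
      0 < f x k j * f x l j) :
    ∃ x, ∃ π : Equiv.Perm (Fin (d + 1)), ∀ i, ‖f x (π i)‖ - η < f x (π i) i := by
  let a := fun x k j => softThreshold (f x k j) (‖f x k‖ - η)
  let N := fun x k => ∑ j, |a x k j|
  have hτ : ∀ x k, 0 ≤ ‖f x k‖ - η := fun x k => sub_nonneg.2 (hη' x k)
  have hrowc : ∀ k, Continuous fun x => f x k := fun k => (continuous_apply k).comp hcont
  have hentry : ∀ k j, Continuous fun x => f x k j := fun k j =>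
    (continuous_apply j).comp (hrowc k)
  have hac : ∀ k j, Continuous fun x => a x k j := by
    intro k j
    have h1 := hentry k j
    have h2 := (hrowc k).norm
    exact (((h1.sub (h2.sub continuous_const)).max continuous_const).sub
      ((h1.neg.sub (h2.sub continuous_const)).max continuous_const))
  have haodd : ∀ x k j, a (-x) k j = -a x k j := by
    intro x k j
    have h : f (-x) k = -f x k := by rw [hodd]; rfl
    simp only [a, h, Pi.neg_apply, norm_neg, softThreshold_neg]
  have hN : ∀ x k, 0 < N x k := by
    intro x k
    obtain ⟨j, hj⟩ := Finite.exists_max fun j => |f x k j|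
    have hnorm : ‖f x k‖ ≤ |f x k j| := (pi_norm_le_iff_of_nonneg (abs_nonneg _)).2 hj
    refine Finset.sum_pos' (fun _ _ => abs_nonneg _) ⟨j, Finset.mem_univ _, abs_pos.2 ?_⟩
    exact softThreshold_ne_zero (hτ x k) (by linarith)
  have hNodd : ∀ x k, N (-x) k = N x k := fun x k => by simp [N, haodd]
  have hNc : ∀ k, Continuous fun x => N x k := fun k =>
    continuous_finsetSum _ fun j _ => (hac k j).abs
  obtain ⟨x, c, hc, hx⟩ := exists_forall_eq_of_odd (F := fun x j => ∑ k, a x k j / N x k)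
    (continuous_pi fun j => continuous_finsetSum _ fun k _ =>
      (hac k j).div (hNc k) fun x => (hN x k).ne')
    (fun x => by
      funext j
      simp [haodd, hNodd, neg_div])
  let B : Matrix (Fin (d + 1)) (Fin (d + 1)) ℝ := Matrix.of fun k j => a x k j / N x k
  have hcol : ∀ k l j, 0 ≤ B k j * B l j := by
    intro k l j
    simp only [B, Matrix.of_apply]
    rw [div_mul_div_comm]
    refine div_nonneg ?_ (mul_pos (hN x k) (hN x l)).le
    rcases eq_or_ne k l with rfl | hkl
    · exact mul_self_nonneg _
    · exact softThreshold_mul_nonneg (hτ x k) (hτ x l) (hsign x k l j hkl)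
  have hrow : ∀ k, ∑ j, |B k j| = 1 := by
    intro k
    simp only [B, Matrix.of_apply, abs_div, abs_of_pos (hN x k)]
    rw [← Finset.sum_div]
    exact div_self (hN x k).ne'
  obtain ⟨π, hπ⟩ := exists_perm_pos hcol hrow hc hx
  refine ⟨x, π, fun i => (softThreshold_pos_iff (hτ x _)).1 ?_⟩
  exact (div_pos_iff_of_pos_right (hN x _)).1 (hπ i)

/-- Finitely many positive continuous functions on a compact space are uniformly bounded below. -/
lemma eventually_le_of_pos {S : Type*} [TopologicalSpace S] [CompactSpace S] {ι : Type*} [Finite ι]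
    {q : ι → S → ℝ} (hq : ∀ i, Continuous (q i)) (hpos : ∀ i x, 0 < q i x) :
    ∀ᶠ ε in 𝓝[>] (0 : ℝ), ∀ i x, ε ≤ q i x := by
  rw [eventually_all]
  intro i
  rcases isEmpty_or_nonempty S with hS | hS
  · exact Eventually.of_forall fun _ x => hS.elim x
  obtain ⟨x₀, -, hx₀⟩ := isCompact_univ.exists_isMinOn Set.univ_nonempty (hq i).continuousOn
  filter_upwards [Ioc_mem_nhdsGT (hpos i x₀)] with ε hε x
  exact hε.2.trans (hx₀ (Set.mem_univ x))

theorem theorem1 (d : ℕ)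
    (f : Metric.sphere (0 : EuclideanSpace ℝ (Fin (d + 1))) 1 →
      Matrix (Fin (d + 1)) (Fin (d + 1)) ℝ)
    (hcont : Continuous f) (hodd : ∀ x, f (-x) = -f x) :
    ∃ x : Metric.sphere (0 : EuclideanSpace ℝ (Fin (d + 1))) 1,
      ¬ RowsInIntersectingCubeFacets (f x) ∨
      ∃ π : Equiv.Perm (Fin (d + 1)), ∀ i : Fin (d + 1),
        0 ≤ f x (π i) i ∧ ∀ j : Fin (d + 1), |f x (π i) j| ≤ |f x (π i) i| := by
  by_contra! H
  have hRICF := fun x => (H x).1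
  have hrowc : ∀ k, Continuous fun x => f x k := fun k => (continuous_apply k).comp hcont
  have hentry : ∀ k j, Continuous fun x => f x k j := fun k j =>
    (continuous_apply j).comp (hrowc k)
  have hle : ∀ x k j, |f x k j| ≤ ‖f x k‖ := fun x k j => norm_le_pi_norm (f x k) j
  have hfail : ∀ x (π : Equiv.Perm (Fin (d + 1))), ∃ i, f x (π i) i < ‖f x (π i)‖ := by
    intro x π
    by_contra! h
    obtain ⟨i, hi⟩ := (H x).2 π
    have h0 : 0 ≤ f x (π i) i := (norm_nonneg _).trans (h i)
    obtain ⟨j, hj⟩ := hi h0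
    rw [abs_of_nonneg h0] at hj
    exact absurd ((hle x (π i) j).trans (h i)) hj.not_ge
  -- with at least two rows the hypothesis excludes zero rows; a zero row of a `1 × 1` matrix would
  -- satisfy the conclusion
  have hrow : ∀ k x, 0 < ‖f x k‖ := by
    intro k x
    rw [norm_pos_iff]
    intro h0
    by_cases hk : ∃ l, k ≠ l
    · obtain ⟨l, hkl⟩ := hk
      obtain ⟨j, hj⟩ := Finite.exists_max fun j => |f x l j|
      have := hRICF x k l hkl j fun i => ⟨by simp [h0], hj i⟩
      simp [h0] at this
    · push Not at hk
      obtain ⟨i, hi⟩ := hfail x 1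
      rw [Equiv.Perm.one_apply, ← hk i, h0] at hi
      simp at hi
  have hS : CompactSpace (Metric.sphere (0 : EuclideanSpace ℝ (Fin (d + 1))) 1) :=
    isCompact_iff_compactSpace.1 (isCompact_sphere _ _)
  have h1 := eventually_le_of_pos (fun k => (hrowc k).norm) hrow
  have h2 := eventually_le_of_pos
    (q := fun (p : {p : Fin (d + 1) × Fin (d + 1) // p.1 ≠ p.2} × Fin (d + 1)) x =>
      max (max (‖f x p.1.1.1‖ - |f x p.1.1.1 p.2|) (‖f x p.1.1.2‖ - |f x p.1.1.2 p.2|))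
        (f x p.1.1.1 p.2 * f x p.1.1.2 p.2))
    (fun p => ((((hrowc _).norm.sub (hentry _ _).abs).max
      ((hrowc _).norm.sub (hentry _ _).abs)).max ((hentry _ _).mul (hentry _ _))))
    (by
      rintro ⟨⟨⟨k, l⟩, hkl⟩, j⟩ x
      simp only [lt_max_iff, sub_pos]
      by_contra! h
      refine absurd (hRICF x k l hkl j fun i => ⟨?_, ?_⟩) h.2.not_gt
      · exact (hle x k i).trans h.1.1
      · exact (hle x l i).trans h.1.2)
  have h3 := eventually_le_of_pos
    (q := fun (π : Equiv.Perm (Fin (d + 1))) x =>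
      (∑ i, (‖f x (π i)‖ - f x (π i) i)) / (d + 1 : ℕ))
    (fun π => (continuous_finsetSum _ fun i _ =>
      (hrowc _).norm.sub (hentry _ _)).div_const _)
    (by
      intro π x
      obtain ⟨i, hi⟩ := hfail x π
      refine div_pos (Finset.sum_pos' (fun i _ => sub_nonneg.2 ?_)
        ⟨i, Finset.mem_univ _, sub_pos.2 hi⟩) (by positivity)
      exact (le_abs_self _).trans (hle x _ i))
  obtain ⟨η, ⟨⟨hη1, hη2⟩, hη3⟩, hη⟩ :=
    (((h1.and h2).and h3).and (eventually_mem_nhdsWithin (s := Set.Ioi (0 : ℝ)))).exists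
  obtain ⟨x, π, hπ⟩ := exists_approx_perm hcont hodd hη (fun x k => hη1 k x) (by
    intro x k l j hkl hk hl
    rcases le_max_iff.1 (hη2 (⟨(k, l), hkl⟩, j) x) with h | h
    · rcases le_max_iff.1 h with h | h <;> simp only at h <;> linarith
    · exact lt_of_lt_of_le hη h)
  have hlt : ∑ i, (‖f x (π i)‖ - f x (π i) i) < ∑ _i : Fin (d + 1), η :=
    Finset.sum_lt_sum_of_nonempty Finset.univ_nonempty fun i _ => by linarith [hπ i]
  have hge := (le_div_iff₀ (by positivity)).1 (hη3 π x)
  rw [Finset.sum_const, Finset.card_univ, Fintype.card_fin, nsmul_eq_mul, mul_comm] at hlt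
  exact absurd hge hlt.not_ge
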